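/- **Definitions.** Let $m\ge 0$ and $n\ge 1$ be integers. A *fundamental set* of type $(2m+1,n,k)$ is a nonempty set $\mathcal E$ of subsets of $\{1,\dots,n\}$, each having $2m+1$ elements, such that exactly $k$ elements of $\{1,\dots,n\}$ are *indispensable*, that is, belong to every member of $\mathcal E$. A subset of $\{1,\dots,n\}$ is *acceptable* if it contains a member of $\mathcal E$. The *associated complex* $\mathcal P$ is the simplicial complex of all subsets of $\{1,\dots,n\}$ whose complement is acceptable. Put $\mathcal S=\{z\in\mathbb C^n : \{i : z_i\neq 0\}\text{ is acceptable}\}$, an open subset of $\mathbb C^n$. Let $l=(l_1,\dots,l_n)$ be a family of vectors of $\mathbb C^m$ such that $(l_p)_{p\in P}$ spans $\mathbb C^m$ as a real affine space for every $P\in\mathcal E$. The group $\mathbb C^*\times\mathbb C^m$ acts on $\mathcal S$ by $$(\alpha,T)\cdot z=\bigl(\alpha e^{\langle l_1,T\rangle}z_1,\dots,\alpha e^{\langle l_n,T\rangle}z_n\bigr),\qquad \langle u,T\rangle=\sum_{a=1}^m u_aT_a .$$ Let $\mathcal N$ be the orbit space, with the quotient topology. The pair $(\mathcal E,l)$ is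 a *good system* if $\mathcal N$ is compact and can be endowed with a structure of (Hausdorff) complex manifold such that the projection $\mathcal S\to\mathcal N$ is holomorphic; $\mathcal N$ is then called an *LVMB manifold*. For a simplicial complex $K$ on a finite set $V$ (a nonempty family of subsets of $V$ closed under taking subsets; elements of $V$ need not be vertices), the *moment-angle complex* is $$\mathcal Z_{K,V}=\bigcup_{\sigma\in K}\bigl\{z\in\mathbb C^V : |z_i|\le 1 \text{ for all } i\in V,\ |z_i|=1 \text{ for all } i\notin\sigma\bigr\},$$ and we write $\mathcal Z_{K,n}$ when $V=\{1,\dots,n\}$. **Proposition.** Let $(\mathcal E,l)$ be a good system of type $(2m+1,n,k)$ with $k>0$. Then there is an indispensable element, and for every indispensable element $j$ the following holds. No face of $\mathcal P$ contains $j$, so $\mathcal P$ may be regarded as a simplicial complex on the $(n-1)$-element set $V_j=\{1,\dots,n\}\setminus\{j\}$. The LVMB manifold $\mathcal N$ is homeomorphic to the moment-angle complex $\mathcal Z_{\mathcal P,V_j}\subset\mathbb C^{V_j}\cong\mathbb C^{n-1}$ (for $j=n$ this is $\mathcal Z_{\mathcal P,n-1}$), by a homeomorphism $\varphi$ that is induced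 by dividing all coordinates by the $j$-th one: for every $z\in\mathcal Z_{\mathcal P,n}\subset\mathcal S$, $$\varphi([z])=\Bigl(\frac{z_i}{z_j}\Bigr)_{i\in V_j}.$$ -/

import Mathlib

open scoped Manifold ContDiff

namespace LVMB

/-- A simplicial complex on the finite set `ι`: a nonempty family of subsets of `ι`, closed under
passing to subsets. The empty set is always a face, and an element of `ι` need not be a vertex. -/
structure SimplicialCpx (ι : Type*) where
  faces : Set (Finset ι)
  empty_mem : ∅ ∈ faces
  down_closed : ∀ σ ∈ faces, ∀ τ : Finset ι, τ ⊆ σ → τ ∈ faces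

/-- The faces of `K` that are contained in `s`, as a simplicial complex on the set `s`. -/
def SimplicialCpx.restrict {ι : Type*} (K : SimplicialCpx ι) (s : Set ι) :
    SimplicialCpx s where
  faces := {τ | τ.map (Function.Embedding.subtype _) ∈ K.faces}
  empty_mem := by simpa using K.empty_mem
  down_closed := fun σ hσ τ hτ => K.down_closed _ hσ _ (Finset.map_subset_map.2 hτ)

/-- `B_σ`: the points of the closed polydisc all of whose coordinates outside `σ` have modulus 1. -/
def polydiscBlock {ι : Type*} (σ : Finset ι) : Set (ι → ℂ) :=
  {z | (∀ i, ‖z i‖ ≤ 1) ∧ ∀ i, i ∉ σ → ‖z i‖ = 1}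

/-- The moment-angle complex of `K`: the union of the `B_σ` over the faces `σ` of `K`. -/
def momentAngleComplex {ι : Type*} (K : SimplicialCpx ι) : Set (ι → ℂ) :=
  ⋃ σ ∈ K.faces, polydiscBlock σ

/-- A fundamental set: a nonempty set of subsets of `ι`, each having `M` elements. -/
structure FundamentalSet (M : ℕ) (ι : Type*) where
  sets : Set (Finset ι)
  nonempty : sets.Nonempty
  card_eq : ∀ P ∈ sets, P.card = M

namespace FundamentalSet

variable {M : ℕ} {ι : Type*}

/-- A subset is acceptable if it contains a fundamental subset. -/
def Acceptable (E : FundamentalSet M ι) (A : Set ι) : Prop :=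
  ∃ P ∈ E.sets, (P : Set ι) ⊆ A

/-- An element is indispensable if it belongs to every fundamental subset. -/
def Indispensable (E : FundamentalSet M ι) (j : ι) : Prop :=
  ∀ P ∈ E.sets, j ∈ P

/-- `E` is of type `(M, n, k)`: it lives on a set with `n` elements, and exactly `k` of these
elements are indispensable. -/
def HasType (E : FundamentalSet M ι) (n k : ℕ) : Prop :=
  Nat.card ι = n ∧ {j | E.Indispensable j}.ncard = k

/-- The associated complex: the subsets whose complement is acceptable. -/
def associatedComplex (E : FundamentalSet M ι) : SimplicialCpx ι where
  faces := {σ | E.Acceptable (σ : Set ι)ᶜ}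
  empty_mem := by
    obtain ⟨P, hP⟩ := E.nonempty
    exact ⟨P, hP, by simp⟩
  down_closed := by
    rintro σ ⟨P, hP, hPσ⟩ τ hτ
    exact ⟨P, hP, hPσ.trans (Set.compl_subset_compl.2 (Finset.coe_subset.2 hτ))⟩

/-- The open set `S` of the points of `ℂ^ι` whose set of nonzero coordinates is acceptable. -/
def openSet [Finite ι] (E : FundamentalSet M ι) : TopologicalSpace.Opens (ι → ℂ) where
  carrier := {z | E.Acceptable {i | z i ≠ 0}}
  is_open' := by
    have h : {z : ι → ℂ | E.Acceptable {i | z i ≠ 0}} =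
        ⋃ P ∈ E.sets, ⋂ i ∈ P, {z : ι → ℂ | z i ≠ 0} := by
      ext z
      simp [Acceptable, Set.subset_def]
    rw [h]
    refine isOpen_biUnion fun P _ => isOpen_biInter_finset fun i _ => ?_
    exact isOpen_ne_fun (continuous_apply i) continuous_const

end FundamentalSet

/-- The acceptable holomorphic action: `(α, T) · z = (α e^{⟨l_i, T⟩} z_i)_i`, where
`⟨l_i, T⟩` is the bilinear (not hermitian) product. -/
noncomputable def act {m : ℕ} {ι : Type*} (l : ι → Fin m → ℂ) (α : ℂˣ) (T : Fin m → ℂ)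
    (z : ι → ℂ) : ι → ℂ :=
  fun i => (α : ℂ) * Complex.exp (∑ a, l i a * T a) * z i

section Quotient

variable {m : ℕ} {ι : Type*} [Finite ι]

/-- The relation "to be in the same orbit of `ℂˣ × ℂ^m`" on `S`. -/
def orbitSetoid (E : FundamentalSet (2 * m + 1) ι) (l : ι → Fin m → ℂ) : Setoid E.openSet where
  r z w := ∃ (α : ℂˣ) (T : Fin m → ℂ), act l α T z.1 = w.1
  iseqv :=
    { refl := fun z => ⟨1, 0, by ext i; simp [act]⟩
      symm := by
        rintro z w ⟨α, T, h⟩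
        refine ⟨α⁻¹, -T, ?_⟩
        rw [← h]
        ext i
        have hα : (α : ℂ) ≠ 0 := α.ne_zero
        simp only [act, Pi.neg_apply, mul_neg, Finset.sum_neg_distrib, Complex.exp_neg,
          Units.val_inv_eq_inv_val]
        field_simp [Complex.exp_ne_zero]
      trans := by
        rintro z w v ⟨α, T, h⟩ ⟨β, U, h'⟩
        refine ⟨β * α, U + T, ?_⟩
        rw [← h', ← h]
        ext i
        simp only [act, Pi.add_apply, mul_add, Finset.sum_add_distrib, Complex.exp_add,
          Units.val_mul]
        ring }

/-- The orbit space `N` of the holomorphic action restricted to `S`. -/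
def OrbitSpace (E : FundamentalSet (2 * m + 1) ι) (l : ι → Fin m → ℂ) : Type _ :=
  Quotient (orbitSetoid E l)

/-- `N` carries the quotient topology. -/
instance (E : FundamentalSet (2 * m + 1) ι) (l : ι → Fin m → ℂ) :
    TopologicalSpace (OrbitSpace E l) :=
  inferInstanceAs (TopologicalSpace (Quotient (orbitSetoid E l)))

/-- The natural projection `S → N`. -/
def proj (E : FundamentalSet (2 * m + 1) ι) (l : ι → Fin m → ℂ) (z : E.openSet) :
    OrbitSpace E l :=
  Quotient.mk (orbitSetoid E l) z

/-- `(E, l)` is an acceptable system: for each fundamental subset `P`, the points `l_p`, `p ∈ P`,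
span `ℂ^m` as a real affine space. -/
def IsAcceptableSystem (E : FundamentalSet (2 * m + 1) ι) (l : ι → Fin m → ℂ) : Prop :=
  ∀ P ∈ E.sets, affineSpan ℝ (l '' (P : Set ι)) = ⊤

end Quotient

/-- `(E, l)` is a good system: it is an acceptable system whose orbit space `N`, with the quotient
topology, is compact and can be endowed with the structure of a (Hausdorff) complex manifold for
which the projection `S → N` is holomorphic. -/
def IsGoodSystem {m : ℕ} {ι : Type*} [Fintype ι] (E : FundamentalSet (2 * m + 1) ι)
    (l : ι → Fin m → ℂ) : Prop :=
  IsAcceptableSystem E l ∧ CompactSpace (OrbitSpace E l) ∧ T2Space (OrbitSpace E l) ∧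
    ∃ (d : ℕ) (_ : ChartedSpace (Fin d → ℂ) (OrbitSpace E l)),
      IsManifold 𝓘(ℂ, Fin d → ℂ) ω (OrbitSpace E l) ∧
      MDifferentiable 𝓘(ℂ, ι → ℂ) 𝓘(ℂ, Fin d → ℂ) (proj E l)

end LVMB

/-!
Let `S → N` be the quotient map and `Z ⊆ S` the moment-angle complex of the associated complex.
Filling in a coordinate `1` at `j` maps `Z_{P,V_j}` into `Z`, hence continuously into `N`. The
source is compact and `N` is Hausdorff, so only bijectivity is at stake. As `j` is indispensable,
`|z_j| = 1` on `Z`, and dividing by `z_j` moves `z` within its orbit to a filled-in point of `Z`.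

The element `(α, T)` with `|α| = e^s` multiplies the modulus of the `i`-th coordinate by the
exponential of `λ(l_i)`, where `λ` is the affine function `u ↦ s + Re ⟨u, T⟩`.

*Injectivity.* If `(α, T)` carries a point of `Z` to another one, then `λ(l_i) ≤ 0` for all `i` in
one acceptable set and `λ(l_i) ≥ 0` for all `i` in another. Points with moduli `exp (-t λ(l_i)⁺)`
have translates with moduli `exp (-t λ(l_i)⁻)`; as `t → ∞` both families accumulate in `S`, at
points with supports `{λ ≤ 0}` and `{0 ≤ λ}`. As `N` is Hausdorff, these limits lie in one orbit, so
their supports agree and `λ` vanishes at every `l_i`. The spanning condition gives `λ = 0`, whence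
`T = 0`: the two points of `Z` differ by a scalar, which is `1` if both have `j`-th coordinate `1`.

*Surjectivity.* The orbit of `z`, with nonzero coordinates, meets `Z` as soon as some affine
function lies below `x_i = -log |z_i|` at every `l_i`, with equality on an acceptable set.
Compactness of `N` provides such a function up to an error bounded uniformly in `x`; applied to
`t x` and divided by a large `t`, the error becomes arbitrarily small. Hence the orbits meeting `Z`
are dense. They form a closed set, since `Z` is compact and `N` is Hausdorff.
-/

open Filter Topology

namespace LVMB

lemma continuous_extend_of_injective {α β X : Type*} [TopologicalSpace X] {f : α → β}
    (hf : Function.Injective f) (g : β → X) :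
    Continuous fun w : α → X => Function.extend f w g := by
  refine continuous_pi fun b => ?_
  by_cases hb : ∃ a, f a = b
  · obtain ⟨a, rfl⟩ := hb
    simpa only [hf.extend_apply] using continuous_apply a
  · simpa only [Function.extend_apply' _ _ _ hb] using continuous_const

lemma extend_div_eq_inv_smul {ι X : Type*} [CommGroupWithZero X] {j : ι} {z : ι → X}
    (hj : z j ≠ 0) :
    Function.extend Subtype.val (fun i : {i | i ≠ j} => z i / z j) 1 = (z j)⁻¹ • z := by
  ext i
  rcases eq_or_ne i j with rfl | hi
  · rw [Function.extend_apply' _ _ _ (by simp)]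
    simp [hj]
  · exact (Subtype.val_injective.extend_apply _ _ (⟨i, hi⟩ : {i | i ≠ j})).trans
      (div_eq_inv_mul _ _)

section MomentAngle

variable {ι : Type*} {K : SimplicialCpx ι}

lemma isCompact_momentAngleComplex [Finite ι] (K : SimplicialCpx ι) :
    IsCompact (momentAngleComplex K) := by
  refine K.faces.toFinite.isCompact_biUnion fun σ _ => ?_
  refine (isCompact_univ_pi fun _ : ι => isCompact_closedBall (0 : ℂ) 1).of_isClosed_subset ?_
    fun z hz i _ => mem_closedBall_zero_iff.2 (hz.1 i)
  simp only [polydiscBlock, Set.ofPred_and, Set.ofPred_forall]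
  exact (isClosed_iInter fun i => isClosed_le (by fun_prop) continuous_const).inter
    (isClosed_iInter fun i => isClosed_iInter fun _ => isClosed_eq (by fun_prop) continuous_const)

lemma mem_momentAngleComplex {z : ι → ℂ} :
    z ∈ momentAngleComplex K ↔
      ∃ σ ∈ K.faces, (∀ i, ‖z i‖ ≤ 1) ∧ ∀ i, i ∉ σ → ‖z i‖ = 1 := by
  simp only [momentAngleComplex, polydiscBlock, Set.mem_iUnion, exists_prop, Set.mem_ofPred_eq]

lemma smul_mem_momentAngleComplex {c : ℂ} (hc : ‖c‖ = 1) {z : ι → ℂ}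
    (hz : z ∈ momentAngleComplex K) : c • z ∈ momentAngleComplex K := by
  simpa [mem_momentAngleComplex, hc] using hz

lemma extend_one_mem_momentAngleComplex {s : Set ι} {w : s → ℂ} :
    Function.extend Subtype.val w 1 ∈ momentAngleComplex K ↔
      w ∈ momentAngleComplex (K.restrict s) := by
  classical
  have extend_coe (i : s) : Function.extend Subtype.val w 1 i = w i :=
    Subtype.val_injective.extend_apply _ _ i
  have extend_of_notMem {i : ι} (hi : i ∉ s) : Function.extend Subtype.val w 1 i = 1 :=
    Function.extend_apply' _ _ _ (by simpa using hi)
  simp only [mem_momentAngleComplex]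
  constructor
  · rintro ⟨σ, hσ, h_le, h_eq⟩
    refine ⟨σ.subtype (· ∈ s), K.down_closed σ hσ _ ?_, fun i => ?_, fun i hi => ?_⟩
    · rw [Finset.subtype_map]
      exact Finset.filter_subset _ _
    · simpa only [extend_coe] using h_le i
    · simpa only [extend_coe] using h_eq i (mt Finset.mem_subtype.2 hi)
  · rintro ⟨τ, hτ, h_le, h_eq⟩
    refine ⟨_, hτ, fun i => ?_, fun i hi => ?_⟩ <;> by_cases his : i ∈ s
    · simpa only [extend_coe] using (extend_coe ⟨i, his⟩) ▸ h_le ⟨i, his⟩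
    · simp [extend_of_notMem his]
    · exact (extend_coe ⟨i, his⟩).symm ▸ h_eq _ fun h => hi (Finset.mem_map.2 ⟨_, h, rfl⟩)
    · simp [extend_of_notMem his]

end MomentAngle

namespace FundamentalSet

variable {M : ℕ} {ι : Type*} {E : FundamentalSet M ι}

lemma Acceptable.mono {A B : Set ι} (hA : E.Acceptable A) (hAB : A ⊆ B) : E.Acceptable B :=
  let ⟨P, hP, hPA⟩ := hA
  ⟨P, hP, hPA.trans hAB⟩

lemma acceptable_univ : E.Acceptable Set.univ :=
  let ⟨P, hP⟩ := E.nonempty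
  ⟨P, hP, Set.subset_univ _⟩

lemma Indispensable.mem {j : ι} (hj : E.Indispensable j) {A : Set ι} (hA : E.Acceptable A) :
    j ∈ A :=
  let ⟨P, hP, hPA⟩ := hA
  hPA (hj P hP)

lemma isOpen_setOf_acceptable {X : Type*} [TopologicalSpace X] {U : ι → Set X}
    (hU : ∀ i, IsOpen (U i)) : IsOpen {x | E.Acceptable {i | x ∈ U i}} := by
  have : {x | E.Acceptable {i | x ∈ U i}} = ⋃ P ∈ E.sets, ⋂ i ∈ P, U i := by
    ext x
    simp [Acceptable, Set.subset_def]
  rw [this]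
  exact isOpen_biUnion fun P _ => isOpen_biInter_finset fun i _ => hU i

variable [Finite ι]

lemma mem_openSet {z : ι → ℂ} : z ∈ E.openSet ↔ E.Acceptable {i | z i ≠ 0} :=
  Iff.rfl

lemma mem_openSet_of_forall_ne_zero {z : ι → ℂ} (hz : ∀ i, z i ≠ 0) : z ∈ E.openSet :=
  acceptable_univ.mono fun i _ => hz i

lemma continuous_openSet_norm_apply (i : ι) : Continuous fun z : E.openSet => ‖z.1 i‖ :=
  ((continuous_apply i).comp continuous_subtype_val).norm

variable (E) in
lemma exists_mem_openSet_norm_eq_exp (x : ι → ℝ) :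
    ∃ z : E.openSet, ∀ i, ‖z.1 i‖ = Real.exp (x i) :=
  ⟨⟨fun i => Complex.exp (x i), mem_openSet_of_forall_ne_zero fun _ => Complex.exp_ne_zero _⟩,
    fun i => by rw [Complex.norm_exp, Complex.ofReal_re]⟩

lemma mem_momentAngleComplex_associatedComplex {z : ι → ℂ} :
    z ∈ momentAngleComplex E.associatedComplex ↔
      (∀ i, ‖z i‖ ≤ 1) ∧ E.Acceptable {i | ‖z i‖ = 1} := by
  classical
  cases nonempty_fintype ι
  rw [mem_momentAngleComplex]
  constructor
  · rintro ⟨σ, hσ, h_le, h_eq⟩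
    exact ⟨h_le, hσ.mono h_eq⟩
  · rintro ⟨h_le, P, hP, h_eq⟩
    exact ⟨Pᶜ, ⟨P, hP, by simp⟩, h_le, fun i hi => h_eq (by simpa using hi)⟩

lemma momentAngleComplex_subset_openSet :
    momentAngleComplex E.associatedComplex ⊆ E.openSet := fun z hz =>
  (mem_momentAngleComplex_associatedComplex.1 hz).2.mono fun i (hi : ‖z i‖ = 1) =>
    norm_ne_zero_iff.1 (hi.trans_ne one_ne_zero)

end FundamentalSet

open FundamentalSet

section LogScale

variable {m : ℕ} {ι : Type*} {l : ι → Fin m → ℂ}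

/-- The affine function `u ↦ s + Re ⟨u, T⟩` on `ℂ^m`: an element `(α, T)` with `|α| = e^s` rescales
the modulus of a coordinate with weight `u` by the exponential of its value. -/
noncomputable def logScale (s : ℝ) (T : Fin m → ℂ) : (Fin m → ℂ) →ᵃ[ℝ] ℝ :=
  AffineMap.const ℝ _ s +
    (Complex.reLm ∘ₗ (Fintype.linearCombination ℂ T).restrictScalars ℝ).toAffineMap

lemma logScale_apply (s : ℝ) (T u : Fin m → ℂ) :
    logScale s T u = s + (∑ a, u a * T a).re :=
  rfl

lemma logScale_mul_smul (c s : ℝ) (T u : Fin m → ℂ) :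
    logScale (c * s) (c • T) u = c * logScale s T u := by
  simp only [logScale_apply, Pi.smul_apply, mul_smul_comm, ← Finset.smul_sum, Complex.smul_re,
    smul_eq_mul, mul_add]

lemma eq_zero_of_logScale_eq_zero {s : ℝ} {T : Fin m → ℂ} (h : logScale s T = 0) :
    s = 0 ∧ T = 0 := by
  have h_eval (u : Fin m → ℂ) : s + (∑ a, u a * T a).re = 0 := DFunLike.congr_fun h u
  have hs : s = 0 := by simpa using h_eval 0
  refine ⟨hs, funext fun a => Complex.normSq_eq_zero.1 ?_⟩
  simpa [hs, Pi.single_apply, Complex.normSq_apply] using h_eval (Pi.single a (star (T a)))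

lemma norm_act (α : ℂˣ) (T : Fin m → ℂ) (z : ι → ℂ) (i : ι) :
    ‖act l α T z i‖ = Real.exp (logScale (Real.log ‖(α : ℂ)‖) T (l i)) * ‖z i‖ := by
  have hα : 0 < ‖(α : ℂ)‖ := norm_pos_iff.2 α.ne_zero
  simp only [act, norm_mul, Complex.norm_exp, logScale_apply, Real.exp_add, Real.exp_log hα]

lemma act_zero (α : ℂˣ) (z : ι → ℂ) : act l α 0 z = (α : ℂ) • z := by
  ext i
  simp [act]

lemma continuous_act (α : ℂˣ) (T : Fin m → ℂ) : Continuous (act l α T) := by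
  unfold act
  fun_prop

lemma act_ne_zero_iff {α : ℂˣ} {T : Fin m → ℂ} {z : ι → ℂ} {i : ι} :
    act l α T z i ≠ 0 ↔ z i ≠ 0 := by
  simp [act, Complex.exp_ne_zero]

end LogScale

section OrbitSpace

variable {m : ℕ} {ι : Type*} [Finite ι] {E : FundamentalSet (2 * m + 1) ι} {l : ι → Fin m → ℂ}

lemma proj_eq_proj {z w : E.openSet} :
    proj E l z = proj E l w ↔ ∃ (α : ℂˣ) (T : Fin m → ℂ), act l α T z.1 = w.1 :=
  Quotient.eq (r := orbitSetoid E l)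

lemma act_mem_openSet (α : ℂˣ) (T : Fin m → ℂ) {z : ι → ℂ} (hz : z ∈ E.openSet) :
    act l α T z ∈ E.openSet :=
  hz.mono fun _ => act_ne_zero_iff.2

lemma isOpenQuotientMap_proj : IsOpenQuotientMap (proj E l) := by
  refine ⟨Quotient.mk_surjective, continuous_quotient_mk', fun U hU => ?_⟩
  have h_saturation : proj E l ⁻¹' (proj E l '' U) = ⋃ (α : ℂˣ) (T : Fin m → ℂ),
      (fun z : E.openSet => (⟨act l α T z.1, act_mem_openSet α T z.2⟩ : E.openSet)) ⁻¹' U := by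
    ext z
    simp only [Set.mem_preimage, Set.mem_image, Set.mem_iUnion]
    constructor
    · rintro ⟨w, hw, hwz⟩
      obtain ⟨α, T, h⟩ := proj_eq_proj.1 hwz.symm
      exact ⟨α, T, by simpa only [h] using hw⟩
    · rintro ⟨α, T, h⟩
      exact ⟨_, h, (proj_eq_proj.2 ⟨α, T, rfl⟩).symm⟩
  refine isOpen_coinduced.2 (show IsOpen (proj E l ⁻¹' (proj E l '' U)) from ?_)
  rw [h_saturation]
  exact isOpen_iUnion fun α => isOpen_iUnion fun T =>
    hU.preimage (((continuous_act α T).comp continuous_subtype_val).subtype_mk _)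

lemma ne_zero_iff_of_proj_eq {z w : E.openSet} (h : proj E l z = proj E l w) (i : ι) :
    z.1 i ≠ 0 ↔ w.1 i ≠ 0 := by
  obtain ⟨α, T, h⟩ := proj_eq_proj.1 h
  rw [← h, act_ne_zero_iff]

lemma exists_norm_eq_of_proj_eq {z w : E.openSet} (h : proj E l z = proj E l w) :
    ∃ s T, ∀ i, ‖w.1 i‖ = Real.exp (logScale s T (l i)) * ‖z.1 i‖ := by
  obtain ⟨α, T, h⟩ := proj_eq_proj.1 h
  exact ⟨_, T, fun i => h ▸ norm_act α T z.1 i⟩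

lemma exists_proj_eq_and_norm_eq (z : E.openSet) (s : ℝ) (T : Fin m → ℂ) :
    ∃ w : E.openSet, proj E l z = proj E l w ∧
      ∀ i, ‖w.1 i‖ = Real.exp (logScale s T (l i)) * ‖z.1 i‖ := by
  let α : ℂˣ := Units.mk0 (Complex.exp s) (Complex.exp_ne_zero _)
  have hα : Real.log ‖(α : ℂ)‖ = s := by simp [α, Complex.norm_exp]
  exact ⟨⟨_, act_mem_openSet α T z.2⟩, proj_eq_proj.2 ⟨α, T, rfl⟩, fun i => by
    rw [norm_act, hα]⟩

end OrbitSpace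

section Hausdorff

lemma exists_tendsto_of_tendsto_norm {κ F : Type*} [NormedAddCommGroup F] [ProperSpace F]
    {u : Ultrafilter κ} {f : κ → F} {r : ℝ} (hf : Tendsto (fun k => ‖f k‖) u (𝓝 r)) :
    ∃ a, Tendsto f u (𝓝 a) ∧ ‖a‖ = r := by
  have h_bounded : Metric.closedBall 0 (r + 1) ∈ u.map f := by
    filter_upwards [hf.eventually_lt_const (lt_add_one r)] with k hk
    exact mem_closedBall_zero_iff.2 hk.le
  obtain ⟨a, -, ha⟩ := (isCompact_closedBall (0 : F) (r + 1)).ultrafilter_le_nhds (u.map f)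
    (le_principal_iff.2 h_bounded)
  exact ⟨a, ha, tendsto_nhds_unique (Tendsto.norm ha) hf⟩

lemma tendsto_exp_neg_mul_atTop {c : ℝ} (hc : 0 ≤ c) :
    Tendsto (fun t : ℝ => Real.exp (-(t * c))) atTop (𝓝 (if c = 0 then 1 else 0)) := by
  split_ifs with h
  · simp [h]
  · exact Real.tendsto_exp_neg_atTop_nhds_zero.comp
      (tendsto_id.atTop_mul_const (hc.lt_of_ne' h))

variable {m : ℕ} {ι : Type*} [Finite ι] {E : FundamentalSet (2 * m + 1) ι} {l : ι → Fin m → ℂ}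
  [T2Space (OrbitSpace E l)]

lemma ne_zero_iff_of_tendsto_norm {κ : Type*} {F : Filter κ} [F.NeBot] {x y : κ → E.openSet}
    (hxy : ∀ k, proj E l (x k) = proj E l (y k)) {r s : ι → ℝ}
    (hx : ∀ i, Tendsto (fun k => ‖(x k).1 i‖) F (𝓝 (r i)))
    (hy : ∀ i, Tendsto (fun k => ‖(y k).1 i‖) F (𝓝 (s i)))
    (hr : E.Acceptable {i | r i ≠ 0}) (hs : E.Acceptable {i | s i ≠ 0}) (i : ι) :
    r i ≠ 0 ↔ s i ≠ 0 := by
  let u := Ultrafilter.of F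
  choose a hxa har using fun i =>
    exists_tendsto_of_tendsto_norm ((hx i).mono_left (Ultrafilter.of_le F))
  choose b hyb hbs using fun i =>
    exists_tendsto_of_tendsto_norm ((hy i).mono_left (Ultrafilter.of_le F))
  have ha : a ∈ E.openSet := hr.mono fun i hi => norm_ne_zero_iff.1 ((har i).trans_ne hi)
  have hb : b ∈ E.openSet := hs.mono fun i hi => norm_ne_zero_iff.1 ((hbs i).trans_ne hi)
  have tendsto_proj {x : κ → E.openSet} {a : E.openSet}
      (hx : ∀ i, Tendsto (fun k => (x k).1 i) u (𝓝 (a.1 i))) :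
      Tendsto (proj E l ∘ x) u (𝓝 (proj E l a)) :=
    (isOpenQuotientMap_proj.continuous.tendsto a).comp
      (tendsto_subtype_rng.2 (tendsto_pi_nhds.2 hx))
  have hab : proj E l ⟨a, ha⟩ = proj E l ⟨b, hb⟩ :=
    tendsto_nhds_unique ((tendsto_proj hxa).congr hxy) (tendsto_proj hyb)
  simpa only [← har, ← hbs, norm_ne_zero_iff] using ne_zero_iff_of_proj_eq hab i

lemma logScale_eq_zero_of_acceptable {s : ℝ} {T : Fin m → ℂ}
    (h_nonpos : E.Acceptable {i | logScale s T (l i) ≤ 0})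
    (h_nonneg : E.Acceptable {i | 0 ≤ logScale s T (l i)}) (i : ι) :
    logScale s T (l i) = 0 := by
  let c (i : ι) : ℝ := logScale s T (l i)
  choose x norm_x using fun t : ℝ =>
    E.exists_mem_openSet_norm_eq_exp fun i => -(t * (c i)⁺)
  choose y proj_y norm_y using fun t : ℝ =>
    exists_proj_eq_and_norm_eq (l := l) (x t) (t * s) (t • T)
  replace norm_y (t : ℝ) (i : ι) : ‖(y t).1 i‖ = Real.exp (-(t * (c i)⁻)) := by
    rw [norm_y, norm_x, logScale_mul_smul, ← Real.exp_add, ← mul_neg, ← mul_add, ← mul_neg]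
    congr 2
    linear_combination -posPart_sub_negPart (c i)
  have h_iff := ne_zero_iff_of_tendsto_norm proj_y
    (fun i => by simpa only [norm_x] using tendsto_exp_neg_mul_atTop (posPart_nonneg (c i)))
    (fun i => by simpa only [norm_y] using tendsto_exp_neg_mul_atTop (negPart_nonneg (c i)))
    (by simpa [c] using h_nonpos) (by simpa [c] using h_nonneg) i
  have h_le_iff : c i ≤ 0 ↔ 0 ≤ c i := by simpa using h_iff
  exact (le_total (c i) 0).elim (fun h => h.antisymm (h_le_iff.1 h))
    fun h => (h_le_iff.2 h).antisymm h

lemma exists_smul_eq_of_proj_eq (hl : IsAcceptableSystem E l) {z w : E.openSet}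
    (hz : z.1 ∈ momentAngleComplex E.associatedComplex)
    (hw : w.1 ∈ momentAngleComplex E.associatedComplex) (h : proj E l z = proj E l w) :
    ∃ α : ℂ, w.1 = α • z.1 := by
  obtain ⟨α, T, h⟩ := proj_eq_proj.1 h
  rw [mem_momentAngleComplex_associatedComplex] at hz hw
  have norm_w (i : ι) := h ▸ norm_act (l := l) α T z.1 i
  have h_zero := logScale_eq_zero_of_acceptable (l := l) (s := Real.log ‖(α : ℂ)‖) (T := T)
    (hz.2.mono fun i (hi : ‖z.1 i‖ = 1) => by
      simpa [norm_w, hi] using hw.1 i)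
    (hw.2.mono fun i (hi : ‖w.1 i‖ = 1) => by
      rw [Set.mem_ofPred_eq, ← Real.one_le_exp_iff, ← hi, norm_w]
      exact mul_le_of_le_one_right (Real.exp_pos _).le (hz.1 i))
  obtain ⟨P, hP⟩ := E.nonempty
  have h_logScale : logScale (Real.log ‖(α : ℂ)‖) T = 0 :=
    AffineMap.ext_on (hl P hP) (Set.forall_mem_image.2 fun i _ => h_zero i)
  exact ⟨α, by rw [← h, (eq_zero_of_logScale_eq_zero h_logScale).2, act_zero]⟩

end Hausdorff

section Compact

variable {m : ℕ} {ι : Type*} [Finite ι] {E : FundamentalSet (2 * m + 1) ι} {l : ι → Fin m → ℂ}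

lemma exists_proj_eq_and_norm_lt [CompactSpace (OrbitSpace E l)] :
    ∃ C, ∀ z : E.openSet, ∃ w : E.openSet, proj E l z = proj E l w ∧
      (∀ i, ‖w.1 i‖ < Real.exp C) ∧ E.Acceptable {i | Real.exp (-C) < ‖w.1 i‖} := by
  let U (C : ℝ) : Set E.openSet :=
    {w | (∀ i, ‖w.1 i‖ < Real.exp C) ∧ E.Acceptable {i | Real.exp (-C) < ‖w.1 i‖}}
  have isOpen_U (C : ℝ) : IsOpen (U C) := by
    refine IsOpen.and ?_ (isOpen_setOf_acceptable fun i =>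
      isOpen_lt continuous_const (continuous_openSet_norm_apply i))
    simp only [Set.ofPred_forall]
    exact isOpen_iInter_of_finite fun i =>
      isOpen_lt (continuous_openSet_norm_apply i) continuous_const
  have monotone_U : Monotone U := fun C D hCD w hw =>
    ⟨fun i => (hw.1 i).trans_le (Real.exp_le_exp.2 hCD), hw.2.mono fun i hi =>
      (Real.exp_le_exp.2 (neg_le_neg hCD)).trans_lt hi⟩
  have exists_mem_U (w : E.openSet) : ∃ C, w ∈ U C := by
    have h_lt : ∀ᶠ C in atTop, ∀ i, ‖w.1 i‖ < Real.exp C :=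
      eventually_all.2 fun i => Real.tendsto_exp_atTop.eventually_gt_atTop _
    have h_gt : ∀ᶠ C in atTop, ∀ i, w.1 i ≠ 0 → Real.exp (-C) < ‖w.1 i‖ :=
      eventually_all.2 fun i => eventually_imp_distrib_left.2 fun hi =>
        Real.tendsto_exp_neg_atTop_nhds_zero.eventually_lt_const (norm_pos_iff.2 hi)
    obtain ⟨C, hC_lt, hC_gt⟩ := (h_lt.and h_gt).exists
    exact ⟨C, hC_lt, (mem_openSet.1 w.2).mono hC_gt⟩
  obtain ⟨C, hC⟩ := isCompact_univ.elim_directed_cover (fun C => proj E l '' U C)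
    (fun C => isOpenQuotientMap_proj.isOpenMap _ (isOpen_U C))
    (fun q _ => by
      obtain ⟨w, rfl⟩ := isOpenQuotientMap_proj.surjective q
      obtain ⟨C, hC⟩ := exists_mem_U w
      exact Set.mem_iUnion.2 ⟨C, w, hC, rfl⟩)
    (Monotone.directed_le fun C D hCD => Set.image_mono (monotone_U hCD))
  refine ⟨C, fun z => ?_⟩
  obtain ⟨w, hw, h⟩ := hC (Set.mem_univ (proj E l z))
  exact ⟨w, h.symm, hw⟩

lemma exists_logScale_le_add_const [CompactSpace (OrbitSpace E l)] :
    ∃ C, ∀ x : ι → ℝ, ∃ s T, (∀ i, logScale s T (l i) ≤ x i + C) ∧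
      E.Acceptable {i | x i - C ≤ logScale s T (l i)} := by
  obtain ⟨C, hC⟩ := exists_proj_eq_and_norm_lt (E := E) (l := l)
  refine ⟨C, fun x => ?_⟩
  obtain ⟨z, norm_z⟩ := E.exists_mem_openSet_norm_eq_exp (-x)
  obtain ⟨w, h_proj, h_lt, h_gt⟩ := hC z
  obtain ⟨s, T, h_norm⟩ := exists_norm_eq_of_proj_eq h_proj
  replace h_norm (i : ι) : ‖w.1 i‖ = Real.exp (logScale s T (l i) - x i) := by
    rw [h_norm, norm_z, ← Real.exp_add, Pi.neg_apply, sub_eq_add_neg]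
  simp only [h_norm, Real.exp_lt_exp] at h_lt h_gt
  refine ⟨s, T, fun i => ?_, h_gt.mono fun i hi => ?_⟩
  · linarith [h_lt i]
  · simp only [Set.mem_ofPred_eq] at hi ⊢
    linarith

lemma exists_logScale_le_add [CompactSpace (OrbitSpace E l)] (x : ι → ℝ) {ε : ℝ} (hε : 0 < ε) :
    ∃ s T, (∀ i, logScale s T (l i) ≤ x i + ε) ∧
      E.Acceptable {i | x i - ε ≤ logScale s T (l i)} := by
  obtain ⟨C, hC⟩ := exists_logScale_le_add_const (E := E) (l := l)
  obtain ⟨t, ht, hCt⟩ : ∃ t : ℝ, 0 < t ∧ C ≤ t * ε :=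
    ⟨max 1 (C / ε), by positivity, (div_le_iff₀ hε).1 (le_max_right _ _)⟩
  obtain ⟨s, T, h_le, h_ge⟩ := hC (t • x)
  simp only [Pi.smul_apply, smul_eq_mul] at h_le h_ge
  refine ⟨t⁻¹ * s, t⁻¹ • T, fun i => ?_, h_ge.mono fun i hi => ?_⟩
  · rw [logScale_mul_smul, inv_mul_le_iff₀ ht]
    linarith [h_le i]
  · simp only [Set.mem_ofPred_eq] at hi ⊢
    rw [logScale_mul_smul, le_inv_mul_iff₀ ht]
    linarith

/-- The functions on `ι` which have a supporting affine function: one of the `logScale s T` lies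
below them and touches them on an acceptable set. Choosing `(s, T)` for `-log |z|`
amounts to moving `z` along its orbit into the moment-angle complex. -/
def supportedFunctions (E : FundamentalSet (2 * m + 1) ι) (l : ι → Fin m → ℂ) : Set (ι → ℝ) :=
  {x | ∃ s T, (∀ i, logScale s T (l i) ≤ x i) ∧ E.Acceptable {i | logScale s T (l i) = x i}}

/-- The points of `S` whose orbits meet the moment-angle complex. -/
def momentAngleSaturation (E : FundamentalSet (2 * m + 1) ι) (l : ι → Fin m → ℂ) :
    Set E.openSet :=
  proj E l ⁻¹' (proj E l '' (Subtype.val ⁻¹' momentAngleComplex E.associatedComplex))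

lemma dense_supportedFunctions [CompactSpace (OrbitSpace E l)] :
    Dense (supportedFunctions E l) := by
  classical
  cases nonempty_fintype ι
  refine fun x => Metric.mem_closure_iff.2 fun ε hε => ?_
  obtain ⟨s, T, h_le, h_ge⟩ := exists_logScale_le_add (E := E) (l := l) x (half_pos hε)
  let y (i : ι) : ℝ := if x i - ε / 2 ≤ logScale s T (l i) then logScale s T (l i) else x i
  have hy : y ∈ supportedFunctions E l := by
    refine ⟨s, T, fun i => ?_, h_ge.mono fun i hi => (if_pos hi).symm⟩
    by_cases hi : x i - ε / 2 ≤ logScale s T (l i)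
    · exact (if_pos hi).ge
    · simp only [y, if_neg hi]
      linarith
  refine ⟨y, hy, ((dist_pi_le_iff (half_pos hε).le).2 fun i => ?_).trans_lt (half_lt_self hε)⟩
  rw [Real.dist_eq, abs_le]
  by_cases hi : x i - ε / 2 ≤ logScale s T (l i)
  · simp only [y, if_pos hi]
    constructor <;> linarith [h_le i]
  · simp only [y, if_neg hi]
    constructor <;> linarith

lemma mem_momentAngleSaturation_of_neg_log_mem {z : E.openSet} (hz : ∀ i, z.1 i ≠ 0)
    (h : (fun i => -Real.log ‖z.1 i‖) ∈ supportedFunctions E l) :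
    z ∈ momentAngleSaturation E l := by
  obtain ⟨s, T, h_le, h_eq⟩ := h
  obtain ⟨w, h_proj, h_norm⟩ := exists_proj_eq_and_norm_eq (l := l) z s T
  replace h_norm (i : ι) : ‖w.1 i‖ = Real.exp (logScale s T (l i) + Real.log ‖z.1 i‖) := by
    rw [h_norm, Real.exp_add, Real.exp_log (norm_pos_iff.2 (hz i))]
  refine ⟨w, mem_momentAngleComplex_associatedComplex.2 ⟨fun i => ?_, h_eq.mono fun i hi => ?_⟩,
    h_proj.symm⟩
  · rw [h_norm, Real.exp_le_one_iff]
    linarith [h_le i]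
  · rw [Set.mem_ofPred_eq] at hi ⊢
    rw [h_norm, hi, neg_add_cancel, Real.exp_zero]

lemma mem_closure_momentAngleSaturation [CompactSpace (OrbitSpace E l)] {z : E.openSet}
    (hz : ∀ i, z.1 i ≠ 0) : z ∈ closure (momentAngleSaturation E l) := by
  let x (i : ι) : ℝ := -Real.log ‖z.1 i‖
  have rescale_ne_zero (y : ι → ℝ) (i : ι) : (Real.exp (x i - y i) : ℂ) * z.1 i ≠ 0 :=
    mul_ne_zero (by exact_mod_cast (Real.exp_pos _).ne') (hz i)
  let rescale (y : ι → ℝ) : E.openSet :=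
    ⟨fun i => Real.exp (x i - y i) * z.1 i, mem_openSet_of_forall_ne_zero (rescale_ne_zero y)⟩
  have neg_log_rescale (y : ι → ℝ) : (fun i => -Real.log ‖(rescale y).1 i‖) = y := by
    ext i
    simp only [rescale, norm_mul, Complex.norm_real, Real.norm_eq_abs, Real.abs_exp]
    rw [Real.log_mul (Real.exp_pos _).ne' (norm_ne_zero_iff.2 (hz i)), Real.log_exp]
    ring
  have rescale_x : rescale x = z := Subtype.ext (funext fun i => by simp [rescale])
  have continuous_rescale : Continuous rescale := by
    refine Continuous.subtype_mk (continuous_pi fun i => ?_) _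
    fun_prop
  rw [← rescale_x]
  refine map_mem_closure continuous_rescale (dense_supportedFunctions (E := E) (l := l) x)
    fun y hy => ?_
  exact mem_momentAngleSaturation_of_neg_log_mem (rescale_ne_zero y)
    ((neg_log_rescale y).symm ▸ hy)

lemma dense_momentAngleSaturation [CompactSpace (OrbitSpace E l)] :
    Dense (momentAngleSaturation E l) := by
  have dense_ne_zero : Dense {z : E.openSet | ∀ i, z.1 i ≠ 0} := by
    have := (dense_pi Set.univ fun (_ : ι) _ => dense_compl_singleton (0 : ℂ)).preimage
      E.openSet.isOpenEmbedding'.isOpenMap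
    simpa [Set.preimage, Set.mem_pi] using this
  exact dense_closure.1 (dense_ne_zero.mono fun z => mem_closure_momentAngleSaturation)

lemma isClosed_momentAngleSaturation [T2Space (OrbitSpace E l)] :
    IsClosed (momentAngleSaturation E l) := by
  have isCompact_preimage :
      IsCompact (Subtype.val ⁻¹' momentAngleComplex E.associatedComplex : Set E.openSet) := by
    refine Topology.IsInducing.subtypeVal.isCompact_preimage' (isCompact_momentAngleComplex _) ?_
    simpa using momentAngleComplex_subset_openSet
  exact (isCompact_preimage.image isOpenQuotientMap_proj.continuous).isClosed.preimage
    isOpenQuotientMap_proj.continuous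

lemma momentAngleSaturation_eq_univ [CompactSpace (OrbitSpace E l)] [T2Space (OrbitSpace E l)] :
    momentAngleSaturation E l = Set.univ :=
  isClosed_momentAngleSaturation.closure_eq.symm.trans dense_momentAngleSaturation.closure_eq

end Compact

section Homeomorph

variable {m : ℕ} {ι : Type*} [Finite ι] {E : FundamentalSet (2 * m + 1) ι} {l : ι → Fin m → ℂ}

/-- The map to the orbit space `N` induced by setting the `j`-th coordinate to `1`. -/
noncomputable def projExtendOne (E : FundamentalSet (2 * m + 1) ι) (l : ι → Fin m → ℂ) (j : ι)
    (w : momentAngleComplex (E.associatedComplex.restrict {i | i ≠ j})) : OrbitSpace E l :=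
  proj E l ⟨Function.extend Subtype.val w.1 1,
    momentAngleComplex_subset_openSet (extend_one_mem_momentAngleComplex.2 w.2)⟩

lemma continuous_projExtendOne (j : ι) : Continuous (projExtendOne E l j) :=
  isOpenQuotientMap_proj.continuous.comp
    (((continuous_extend_of_injective Subtype.val_injective 1).comp
      continuous_subtype_val).subtype_mk _)

lemma projExtendOne_injective [T2Space (OrbitSpace E l)] (hl : IsAcceptableSystem E l) (j : ι) :
    Function.Injective (projExtendOne E l j) := by
  intro w w' h
  obtain ⟨α, h_smul⟩ := exists_smul_eq_of_proj_eq hl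
    (extend_one_mem_momentAngleComplex.2 w.2) (extend_one_mem_momentAngleComplex.2 w'.2) h
  have extend_self (w : {i | i ≠ j} → ℂ) : Function.extend Subtype.val w 1 j = 1 :=
    Function.extend_apply' _ _ _ (by simp)
  have hα : α = 1 := by simpa [extend_self] using (congrFun h_smul j).symm
  rw [hα, one_smul] at h_smul
  exact Subtype.ext (Function.extend_injective Subtype.val_injective (1 : ι → ℂ) h_smul.symm)

lemma norm_eq_one_of_indispensable {j : ι} (hj : E.Indispensable j) {z : ι → ℂ}
    (hz : z ∈ momentAngleComplex E.associatedComplex) : ‖z j‖ = 1 :=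
  hj.mem (mem_momentAngleComplex_associatedComplex.1 hz).2

lemma div_mem_momentAngleComplex_restrict {j : ι} (hj : E.Indispensable j) {z : ι → ℂ}
    (hz : z ∈ momentAngleComplex E.associatedComplex) :
    (fun i : {i | i ≠ j} => z i / z j) ∈
      momentAngleComplex (E.associatedComplex.restrict {i | i ≠ j}) := by
  have hzj := norm_eq_one_of_indispensable hj hz
  rw [← extend_one_mem_momentAngleComplex,
    extend_div_eq_inv_smul (norm_ne_zero_iff.1 (hzj.trans_ne one_ne_zero))]
  exact smul_mem_momentAngleComplex (by rw [norm_inv, hzj, inv_one]) hz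

lemma projExtendOne_div {j : ι} (hj : E.Indispensable j) {z : E.openSet}
    (hz : z.1 ∈ momentAngleComplex E.associatedComplex) :
    projExtendOne E l j ⟨_, div_mem_momentAngleComplex_restrict hj hz⟩ = proj E l z := by
  have hzj : z.1 j ≠ 0 := hj.mem z.2
  refine proj_eq_proj.2 ⟨Units.mk0 (z.1 j) hzj, 0, ?_⟩
  exact (act_zero _ _).trans
    ((congrArg (z.1 j • ·) (extend_div_eq_inv_smul hzj)).trans (smul_inv_smul₀ hzj _))

lemma projExtendOne_surjective [CompactSpace (OrbitSpace E l)] [T2Space (OrbitSpace E l)]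
    {j : ι} (hj : E.Indispensable j) : Function.Surjective (projExtendOne E l j) := by
  intro q
  obtain ⟨z, rfl⟩ := isOpenQuotientMap_proj.surjective q
  obtain ⟨w, hw, h⟩ : z ∈ momentAngleSaturation E l :=
    momentAngleSaturation_eq_univ.ge (Set.mem_univ z)
  exact ⟨_, (projExtendOne_div hj hw).trans h⟩

end Homeomorph

end LVMB

open LVMB in
theorem mainTheorem4_general {m : ℕ} {ι : Type*} [Finite ι] {E : FundamentalSet (2 * m + 1) ι}
    {l : ι → Fin m → ℂ} (hl : IsAcceptableSystem E l) [CompactSpace (OrbitSpace E l)]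
    [T2Space (OrbitSpace E l)] {j : ι} (hj : E.Indispensable j) :
    ∃ φ : OrbitSpace E l ≃ₜ momentAngleComplex (E.associatedComplex.restrict {i | i ≠ j}),
      ∀ z : E.openSet, z.1 ∈ momentAngleComplex E.associatedComplex →
        ∀ i : {i | i ≠ j}, (φ (proj E l z)).1 i = z.1 i / z.1 j := by
  have := isCompact_iff_compactSpace.1
    (isCompact_momentAngleComplex (E.associatedComplex.restrict {i | i ≠ j}))
  let ψ := Continuous.homeoOfEquivCompactToT2 (f := Equiv.ofBijective (projExtendOne E l j)
    ⟨projExtendOne_injective hl j, projExtendOne_surjective hj⟩) (continuous_projExtendOne j)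
  refine ⟨ψ.symm, fun z hz i => ?_⟩
  have hψ : ψ.symm (proj E l z) = ⟨_, div_mem_momentAngleComplex_restrict hj hz⟩ :=
    ψ.symm_apply_eq.2 (projExtendOne_div hj hz).symm
  rw [hψ]

theorem mainTheorem4 (m n k : ℕ) (E : LVMB.FundamentalSet (2 * m + 1) (Fin n))
    (l : Fin n → Fin m → ℂ) (hgood : LVMB.IsGoodSystem E l) (htype : E.HasType n k)
    (hk : 0 < k) :
    (∃ j, E.Indispensable j) ∧
    ∀ j, E.Indispensable j →
      ∃ φ : LVMB.OrbitSpace E l ≃ₜ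
          LVMB.momentAngleComplex (E.associatedComplex.restrict {i | i ≠ j}),
        ∀ z : E.openSet, z.1 ∈ LVMB.momentAngleComplex E.associatedComplex →
          ∀ i : {i | i ≠ j}, (φ (LVMB.proj E l z)).1 i = z.1 i / z.1 j := by
  obtain ⟨hl, _, _, -⟩ := hgood
  exact ⟨Set.nonempty_of_ncard_ne_zero (htype.2.trans_ne hk.ne'), fun _ => mainTheorem4_general hl⟩
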